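/- Let $d\ge 1$. A $d$-partite hyper-graph $G$ over disjoint finite totally ordered color classes $A_1,\dots,A_d$ is given by an edge set $E(G)\subseteq A_1\times\cdots\times A_d$. A non-crossing hyper-matching of $G$ is a set $M\subseteq E(G)$ of pairwise node-disjoint edges any two of which are comparable in the coordinatewise order on $A_1\times\cdots\times A_d$; let $L(G)$ be the largest size of such an $M$. A probability distribution $\mathcal F$ over the hyper-graphs over $A_1,\dots,A_d$ has concentration constant $h$ if for every median $\mathrm{Med}$ of $L(\mathcal F)$ (the random variable $L(G)$ with $G$ distributed according to $\mathcal F$) and all $s\ge 0$, $$\Pr\bigl[L(\mathcal F)\le(1-s)\mathrm{Med}\bigr]\le 2\exp\bigl(-hs^2\,\mathrm{Med}\bigr),\qquad \Pr\bigl[L(\mathcal F)\ge(1+s)\mathrm{Med}\bigr]\le 2\exp\Bigl(-h\frac{s^2}{1+s}\,\mathrm{Med}\Bigr).$$ A family of distributions, one for each choice of $A_1,\dots,A_d$, has concentration constant $h$ if each of its members has. (i) For every $p\in[0,1]$, the $d$-dimensional binomial random hyper-graph model, in which each $e\in A_1\times\cdots\times A_d$ is an edge with probability $p$, independently of all others,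 has concentration constant $1/4$. (ii) For every integer $k\ge1$, the random $d$-word model, in which each element of $A_1\cup\cdots\cup A_d$ is independently assigned a uniformly random one of $k$ letters and the edges are the $(v_1,\dots,v_d)\in A_1\times\cdots\times A_d$ whose nodes $v_1,\dots,v_d$ all have the same letter, has concentration constant $1/(4d)$. -/

import Mathlib

open MeasureTheory ProbabilityTheory

universe u

namespace NonCrossing

/-- A `d`-partite hyper-graph over the color classes `A 0, …, A (d - 1)`, given by its edge set,
a subset of `A 0 × … × A (d - 1)`. The color classes are regarded as disjoint: a node is an element
of the disjoint union `Σ i, A i`, and the nodes of the edge `e` are the pairs `⟨i, e i⟩`. -/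
abbrev Hypergraph {d : ℕ} (A : Fin d → Type u) : Type u := Set (∀ i, A i)

section Matching

variable {d : ℕ} {A : Fin d → Type u} [∀ i, LinearOrder (A i)]

/-- A non-crossing hyper-matching: a collection of pairwise node-disjoint edges, any two of which
are comparable in the coordinatewise order (which is Mathlib's order `≤` on `∀ i, A i`). -/
def IsNonCrossingMatching (M : Finset (∀ i, A i)) : Prop :=
  (∀ e ∈ M, ∀ f ∈ M, e ≠ f → ∀ i, e i ≠ f i) ∧ (∀ e ∈ M, ∀ f ∈ M, e ≤ f ∨ f ≤ e)

/-- `L G`: the size of a largest non-crossing hyper-matching contained in the edge set of `G`. -/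
noncomputable def L (G : Hypergraph A) : ℕ :=
  sSup {m : ℕ | ∃ M : Finset (∀ i, A i),
    (∀ e ∈ M, e ∈ G) ∧ IsNonCrossingMatching M ∧ M.card = m}

/-- Over finite color classes the supremum defining `L G` is attained. -/
theorem isGreatest_L [∀ i, Fintype (A i)] (G : Hypergraph A) :
    IsGreatest {m : ℕ | ∃ M : Finset (∀ i, A i),
      (∀ e ∈ M, e ∈ G) ∧ IsNonCrossingMatching M ∧ M.card = m} (L G) := by
  have hb : BddAbove {m : ℕ | ∃ M : Finset (∀ i, A i),
      (∀ e ∈ M, e ∈ G) ∧ IsNonCrossingMatching M ∧ M.card = m} := by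
    refine ⟨Fintype.card (∀ i, A i), ?_⟩
    rintro m ⟨M, -, -, rfl⟩
    exact Finset.card_le_univ M
  refine ⟨Nat.sSup_mem ⟨0, ∅, ?_, ?_, ?_⟩ hb, fun m hm => le_csSup hb hm⟩
  · simp
  · simp [IsNonCrossingMatching]
  · simp

end Matching

/-- `m` is a median of the real random variable `X` under `μ`. -/
def IsMedian {Ω : Type*} [MeasurableSpace Ω] (μ : Measure Ω) (X : Ω → ℝ) (m : ℝ) : Prop :=
  1 / 2 ≤ μ.real {ω | X ω ≤ m} ∧ 1 / 2 ≤ μ.real {ω | m ≤ X ω}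

/-- The distribution `F` over `d`-partite hyper-graphs has concentration constant `h`: the two tail
bounds hold around every median of `L F`, for all `s ≥ 0`. -/
def DistHasConcentrationConstant {d : ℕ} {A : Fin d → Type u} [∀ i, LinearOrder (A i)]
    (F : Measure (Hypergraph A)) (h : ℝ) : Prop :=
  ∀ med : ℝ, IsMedian F (fun H => (L H : ℝ)) med → ∀ s : ℝ, 0 ≤ s →
    F.real {H | (L H : ℝ) ≤ (1 - s) * med} ≤ 2 * Real.exp (-(h * s ^ 2 * med)) ∧
    F.real {H | (1 + s) * med ≤ (L H : ℝ)} ≤ 2 * Real.exp (-(h * (s ^ 2 / (1 + s)) * med))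

/-- A family of distributions: for all finite totally ordered color classes `A 0, …, A (d - 1)`,
a distribution over the hyper-subgraphs of the complete `d`-partite hyper-graph over them. -/
abbrev HypergraphModel (d : ℕ) : Type (u + 1) :=
  ∀ (A : Fin d → Type u) [∀ i, LinearOrder (A i)] [∀ i, Fintype (A i)], Measure (Hypergraph A)

/-- A model has concentration constant `h` if each of its distributions has. -/
def HasConcentrationConstant {d : ℕ} (D : HypergraphModel.{u} d) (h : ℝ) : Prop :=
  ∀ (A : Fin d → Type u) [∀ i, LinearOrder (A i)] [∀ i, Fintype (A i)],
    DistHasConcentrationConstant (D A) h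

/-- The `d`-dimensional binomial random hyper-graph model: each edge of the complete `d`-partite
hyper-graph is present with probability `p`, independently of the other edges. -/
noncomputable def binomialModel (d : ℕ) (p : unitInterval) : HypergraphModel.{u} d :=
  fun A _ _ => setBernoulli (Set.univ : Set (∀ i, A i)) p

/-- Given an assignment `w` of one of `k` letters to each node, the hyper-graph of those edges all
of whose nodes are assigned the same letter. -/
def wordHypergraph {d k : ℕ} {A : Fin d → Type u} (w : (Σ i, A i) → Fin k) : Hypergraph A :=
  {e | ∀ i j, w ⟨i, e i⟩ = w ⟨j, e j⟩}

/-- The random `d`-word model: the law of `wordHypergraph w` when the nodes are assigned letters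
uniformly and independently. -/
noncomputable def wordModel (d k : ℕ) : HypergraphModel.{u} d :=
  fun A _ _ => (Measure.pi fun _ : (Σ i, A i) => uniformOn (Set.univ : Set (Fin k))).map
    wordHypergraph

/-- The word model consists of probability distributions (as does the binomial model). -/
theorem isProbabilityMeasure_wordModel {d k : ℕ} (hk : 1 ≤ k) (A : Fin d → Type u)
    [∀ i, LinearOrder (A i)] [∀ i, Fintype (A i)] :
    IsProbabilityMeasure (wordModel d k A) := by
  have : Nonempty (Fin k) := ⟨⟨0, hk⟩⟩
  exact Measure.isProbabilityMeasure_map (Measurable.of_discrete).aemeasurable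

end NonCrossing

/-! In both models the hyper-graph is a function of independent variables: one truth value per
potential edge, or one letter per node. Each edge is decided by at most `c` variables (`c = 1`,
respectively `c = d`), and distinct edges of a matching use disjoint sets of variables. So changing
one variable destroys at most one edge of a maximum matching, and `L ≥ r` is certified by the at
most `c * r` variables of `r` matched edges (`isLipschitzCertifiable_L`). Comparability of edges
enters only as a property inherited by sub-matchings.

For such a function `X`, Talagrand's inequality `P(A) * E exp(dist² / 4) ≤ 1` yields `P[X ≤ b] * P[r
≤ X] ≤ exp(-(r - b)² / (4 * c * r))`. Taking one threshold to be a median makes one factor at least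
`1 / 2`.

Talagrand's inequality is proved by induction on the number of coordinates: the distance to `A` is
compared with the distances to a slice and to the projection of `A` (`convexDistSq_cons_le`), and
the mixing weight is optimised (`exists_exp_sub_mul_log_le`). -/

section ConvexDistance

open Classical Finset

/-! ### Convex distance as an infimum over mass functions -/

variable {Ω : Type*} [Fintype Ω]

/-- `w` is the mass function of a probability distribution carried by `A`. -/
structure IsMassOn {α : Type*} [Fintype α] (A : Finset α) (w : α → ℝ) : Prop where
  nonneg : ∀ y, 0 ≤ w y
  eq_zero : ∀ y ∉ A, w y = 0
  sum_eq : ∑ y, w y = 1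

/-- The probability, under the mass function `w`, of differing from `x` at coordinate `i`. -/
noncomputable def mismatch {ι : Type*} [Fintype ι] [DecidableEq ι] (w : (ι → Ω) → ℝ) (x : ι → Ω) (i : ι) : ℝ :=
  ∑ y, w y * (if y i ≠ x i then 1 else 0)

/-- The square of Talagrand's convex distance from `x` to `A`. -/
noncomputable def convexDistSq {ι : Type*} [Fintype ι] [DecidableEq ι] (A : Finset (ι → Ω)) (x : ι → Ω) : ℝ :=
  sInf {r | ∃ w, IsMassOn A w ∧ r = ∑ i, mismatch w x i ^ 2}

/-- The weight of `A` under the product of copies of `p`. -/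
noncomputable def prodWeight {ι : Type*} [Fintype ι] (p : Ω → ℝ) (A : Finset (ι → Ω)) : ℝ :=
  ∑ x ∈ A, ∏ i, p (x i)

lemma IsMassOn.single {α : Type*} [Fintype α] {A : Finset α} {a : α} (ha : a ∈ A) :
    IsMassOn A (Pi.single a 1) where
  nonneg y := by by_cases h : y = a <;> simp [h]
  eq_zero y hy := by
    have : y ≠ a := fun h => hy (h ▸ ha)
    simp [this]
  sum_eq := by simp

lemma IsMassOn.convexCombination {α : Type*} [Fintype α] {A : Finset α} {v w : α → ℝ}
    (hv : IsMassOn A v) (hw : IsMassOn A w) {θ : ℝ} (h0 : 0 ≤ θ) (h1 : θ ≤ 1) :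
    IsMassOn A (fun y => θ * v y + (1 - θ) * w y) where
  nonneg y := add_nonneg (mul_nonneg h0 (hv.nonneg y))
    (mul_nonneg (sub_nonneg.2 h1) (hw.nonneg y))
  eq_zero y hy := by simp [hv.eq_zero y hy, hw.eq_zero y hy]
  sum_eq := by
    rw [sum_add_distrib, ← mul_sum, ← mul_sum, hv.sum_eq, hw.sum_eq]
    ring

section Distance

variable {ι : Type*} [Fintype ι] [DecidableEq ι]

lemma mismatch_nonneg {A : Finset (ι → Ω)} {w : (ι → Ω) → ℝ} (hw : IsMassOn A w) (x : ι → Ω)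
    (i : ι) : 0 ≤ mismatch w x i :=
  sum_nonneg fun y _ => mul_nonneg (hw.nonneg y) (by split_ifs <;> simp)

lemma mismatch_le_one {A : Finset (ι → Ω)} {w : (ι → Ω) → ℝ} (hw : IsMassOn A w) (x : ι → Ω)
    (i : ι) : mismatch w x i ≤ 1 := by
  rw [← hw.sum_eq]
  refine sum_le_sum fun y _ => ?_
  have := hw.nonneg y
  split_ifs <;> simp [this]

lemma mismatch_convexCombination (v w : (ι → Ω) → ℝ) (θ : ℝ) (x : ι → Ω) (i : ι) :
    mismatch (fun y => θ * v y + (1 - θ) * w y) x i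
      = θ * mismatch v x i + (1 - θ) * mismatch w x i := by
  simp only [mismatch, mul_sum, ← sum_add_distrib]
  exact sum_congr rfl fun y _ => by ring

lemma convexDistSq_bddBelow (A : Finset (ι → Ω)) (x : ι → Ω) :
    BddBelow {r | ∃ w, IsMassOn A w ∧ r = ∑ i, mismatch w x i ^ 2} :=
  ⟨0, by rintro r ⟨w, -, rfl⟩; positivity⟩

lemma convexDistSq_le {A : Finset (ι → Ω)} {w : (ι → Ω) → ℝ} (hw : IsMassOn A w) (x : ι → Ω) :
    convexDistSq A x ≤ ∑ i, mismatch w x i ^ 2 :=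
  csInf_le (convexDistSq_bddBelow A x) ⟨w, hw, rfl⟩

/-- Nonemptiness matters: for empty `A` the infimum takes the default value `0`. -/
lemma le_convexDistSq {A : Finset (ι → Ω)} (hA : A.Nonempty) {x : ι → Ω} {r : ℝ}
    (h : ∀ w, IsMassOn A w → r ≤ ∑ i, mismatch w x i ^ 2) : r ≤ convexDistSq A x := by
  obtain ⟨a, ha⟩ := hA
  refine le_csInf ⟨_, _, IsMassOn.single ha, rfl⟩ ?_
  rintro _ ⟨w, hw, rfl⟩
  exact h w hw

lemma exists_lt_convexDistSq_add {A : Finset (ι → Ω)} (hA : A.Nonempty) (x : ι → Ω) {ε : ℝ}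
    (hε : 0 < ε) : ∃ w, IsMassOn A w ∧ ∑ i, mismatch w x i ^ 2 < convexDistSq A x + ε := by
  obtain ⟨a, ha⟩ := hA
  obtain ⟨_, ⟨w, hw, rfl⟩, h⟩ := exists_lt_of_csInf_lt
    (s := {r | ∃ w, IsMassOn A w ∧ r = ∑ i, mismatch w x i ^ 2})
    ⟨_, _, IsMassOn.single ha, rfl⟩ (lt_add_of_pos_right (convexDistSq A x) hε)
  exact ⟨w, hw, h⟩

end Distance

/-! ### Splitting off the first coordinate -/

section Slices

variable {n : ℕ}

/-- The points whose extension by the first coordinate `a` is in `A`. -/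
noncomputable def consSlice (A : Finset (Fin (n + 1) → Ω)) (a : Ω) : Finset (Fin n → Ω) :=
  univ.filter fun x => (Fin.cons a x : Fin (n + 1) → Ω) ∈ A

/-- The projection of `A` that forgets the first coordinate. -/
noncomputable def tailImage (A : Finset (Fin (n + 1) → Ω)) : Finset (Fin n → Ω) :=
  univ.filter fun x => ∃ a, (Fin.cons a x : Fin (n + 1) → Ω) ∈ A

/-- The image of the mass function `w` under `y ↦ (s y, y)`. -/
noncomputable def consMass (s : (Fin n → Ω) → Ω) (w : (Fin n → Ω) → ℝ)
    (z : Fin (n + 1) → Ω) : ℝ :=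
  if z 0 = s (Fin.tail z) then w (Fin.tail z) else 0

lemma sum_fin_cons {M : Type*} [AddCommMonoid M] (g : (Fin (n + 1) → Ω) → M) :
    ∑ z, g z = ∑ a, ∑ y, g (Fin.cons a y) := by
  rw [← Fintype.sum_prod_type' (f := fun a y => g (Fin.cons a y))]
  exact (Fintype.sum_equiv (Fin.consEquiv fun _ => Ω) _ _ fun _ => rfl).symm

lemma sum_consMass_mul (s : (Fin n → Ω) → Ω) (w : (Fin n → Ω) → ℝ)
    (g : (Fin (n + 1) → Ω) → ℝ) :
    ∑ z, consMass s w z * g z = ∑ y, w y * g (Fin.cons (s y) y) := by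
  rw [sum_fin_cons, sum_comm]
  refine sum_congr rfl fun y _ => ?_
  rw [sum_eq_single (s y)] <;> simp +contextual [consMass]

lemma IsMassOn.cons {A : Finset (Fin (n + 1) → Ω)} {B : Finset (Fin n → Ω)}
    {w : (Fin n → Ω) → ℝ} (hw : IsMassOn B w) {s : (Fin n → Ω) → Ω}
    (hs : ∀ y ∈ B, (Fin.cons (s y) y : Fin (n + 1) → Ω) ∈ A) : IsMassOn A (consMass s w) where
  nonneg z := by
    unfold consMass
    split_ifs
    exacts [hw.nonneg _, le_rfl]
  eq_zero z hz := by
    unfold consMass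
    split_ifs with h
    · refine hw.eq_zero _ fun hB => hz ?_
      have := hs _ hB
      rwa [← h, Fin.cons_self_tail] at this
    · rfl
  sum_eq := by simpa [hw.sum_eq] using sum_consMass_mul s w fun _ => 1

lemma mismatch_consMass_succ (s : (Fin n → Ω) → Ω) (w : (Fin n → Ω) → ℝ) (a : Ω)
    (x : Fin n → Ω) (i : Fin n) :
    mismatch (consMass s w) (Fin.cons a x : Fin (n + 1) → Ω) i.succ = mismatch w x i := by
  simp only [mismatch, sum_consMass_mul, Fin.cons_succ]

lemma mismatch_consMass_zero (w : (Fin n → Ω) → ℝ) (a : Ω) (x : Fin n → Ω) :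
    mismatch (consMass (fun _ => a) w) (Fin.cons a x : Fin (n + 1) → Ω) 0 = 0 := by
  simp only [mismatch, sum_consMass_mul]
  simp

/-- Lift `w` along a section of the projection; the first coordinate of the lift is not controlled.
-/
lemma exists_isMassOn_of_tailImage {A : Finset (Fin (n + 1) → Ω)} {w : (Fin n → Ω) → ℝ}
    (hw : IsMassOn (tailImage A) w) (a : Ω) (x : Fin n → Ω) :
    ∃ v, IsMassOn A v ∧ ∀ i : Fin n,
      mismatch v (Fin.cons a x : Fin (n + 1) → Ω) i.succ = mismatch w x i := by
  have h : ∀ y : Fin n → Ω, ∃ b : Ω, y ∈ tailImage A → (Fin.cons b y : Fin (n + 1) → Ω) ∈ A := by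
    intro y
    by_cases hy : y ∈ tailImage A
    · obtain ⟨b, hb⟩ := (mem_filter.1 hy).2
      exact ⟨b, fun _ => hb⟩
    · exact ⟨a, fun h => absurd h hy⟩
  choose s hs using h
  exact ⟨consMass s w, hw.cons hs, mismatch_consMass_succ s w a x⟩

lemma convexDistSq_cons_le_one_add {A : Finset (Fin (n + 1) → Ω)} (hA : (tailImage A).Nonempty)
    (a : Ω) (x : Fin n → Ω) :
    convexDistSq A (Fin.cons a x) ≤ 1 + convexDistSq (tailImage A) x := by
  refine le_of_forall_pos_le_add fun ε hε => ?_
  obtain ⟨w, hw, hlt⟩ := exists_lt_convexDistSq_add hA x hε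
  obtain ⟨v, hv, hvw⟩ := exists_isMassOn_of_tailImage hw a x
  refine (convexDistSq_le hv _).trans ?_
  rw [Fin.sum_univ_succ]
  simp only [hvw]
  have h1 := mismatch_le_one hv (Fin.cons a x) 0
  have h0 := mismatch_nonneg hv (Fin.cons a x) 0
  nlinarith

/-- Mix near-optimal masses, with weight `θ` on the slice and `1 - θ` on a lift from the projection.
The slice part agrees with `a` in the first coordinate, so that coordinate costs at most `(1 - θ) ^
2`; convexity of the square handles the others. -/
lemma convexDistSq_cons_le {A : Finset (Fin (n + 1) → Ω)} {a : Ω} (hA : (consSlice A a).Nonempty)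
    (x : Fin n → Ω) {θ : ℝ} (hθ0 : 0 ≤ θ) (hθ1 : θ ≤ 1) :
    convexDistSq A (Fin.cons a x) ≤ (1 - θ) ^ 2 + θ * convexDistSq (consSlice A a) x
      + (1 - θ) * convexDistSq (tailImage A) x := by
  have hT : (tailImage A).Nonempty := by
    obtain ⟨y, hy⟩ := hA
    exact ⟨y, mem_filter.2 ⟨mem_univ _, a, (mem_filter.1 hy).2⟩⟩
  refine le_of_forall_pos_le_add fun ε hε => ?_
  obtain ⟨w₁, hw₁, hlt₁⟩ := exists_lt_convexDistSq_add hA x hε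
  obtain ⟨w₂, hw₂, hlt₂⟩ := exists_lt_convexDistSq_add hT x hε
  have hv₁ : IsMassOn A (consMass (fun _ => a) w₁) := hw₁.cons fun y hy => (mem_filter.1 hy).2
  obtain ⟨v₂, hv₂, hvw₂⟩ := exists_isMassOn_of_tailImage hw₂ a x
  refine (convexDistSq_le (hv₁.convexCombination hv₂ hθ0 hθ1) _).trans ?_
  simp only [mismatch_convexCombination]
  rw [Fin.sum_univ_succ]
  simp only [hvw₂, mismatch_consMass_succ, mismatch_consMass_zero]
  have h1 := mismatch_le_one hv₂ (Fin.cons a x) 0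
  have h0 := mismatch_nonneg hv₂ (Fin.cons a x) 0
  have hconv : ∑ i, (θ * mismatch w₁ x i + (1 - θ) * mismatch w₂ x i) ^ 2
      ≤ θ * ∑ i, mismatch w₁ x i ^ 2 + (1 - θ) * ∑ i, mismatch w₂ x i ^ 2 := by
    rw [mul_sum, mul_sum, ← sum_add_distrib]
    refine sum_le_sum fun i _ => ?_
    have := mul_nonneg (mul_nonneg hθ0 (sub_nonneg.2 hθ1))
      (sq_nonneg (mismatch w₁ x i - mismatch w₂ x i))
    linarith
  have hfirst : (θ * 0 + (1 - θ) * mismatch v₂ (Fin.cons a x) 0) ^ 2 ≤ (1 - θ) ^ 2 := by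
    rw [mul_zero, zero_add]
    exact pow_le_pow_left₀ (mul_nonneg (by linarith) h0)
      (mul_le_of_le_one_right (by linarith) h1) 2
  have e1 := mul_le_mul_of_nonneg_left hlt₁.le hθ0
  have e2 := mul_le_mul_of_nonneg_left hlt₂.le (sub_nonneg.2 hθ1)
  linarith

lemma prodWeight_eq_sum_consSlice (p : Ω → ℝ) (A : Finset (Fin (n + 1) → Ω)) :
    prodWeight p A = ∑ a, p a * prodWeight p (consSlice A a) := by
  have h (B : Finset (Fin (n + 1) → Ω)) : prodWeight p B =
      ∑ z, if z ∈ B then ∏ i, p (z i) else 0 := by simp [prodWeight]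
  rw [h, sum_fin_cons]
  refine sum_congr rfl fun a _ => ?_
  simp only [prodWeight, consSlice, sum_filter, mul_sum, Fin.prod_univ_succ, Fin.cons_zero,
    Fin.cons_succ, mul_ite, mul_zero]

end Slices

/-! ### The one-variable inequality behind the induction -/

section Numeric

/-- In the second-order expansions the terms in `l` and `l ^ 2` cancel, leaving `-l ^ 3`, which
absorbs the remainders when `l ≤ 1 / 2`. -/
lemma exp_sub_sq_add_exp_neg_le {l : ℝ} (h0 : 0 ≤ l) (h1 : l ≤ 1 / 2) :
    Real.exp (l - l ^ 2) + Real.exp (-l) ≤ 2 := by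
  have hx0 : 0 ≤ l - l ^ 2 := by nlinarith
  have hxl : l - l ^ 2 ≤ l := by nlinarith
  have hb := Real.exp_bound (x := l - l ^ 2) (n := 3)
    (by rw [abs_of_nonneg hx0]; linarith) (by norm_num)
  rw [abs_of_nonneg hx0] at hb
  have hb' := (abs_le.1 hb).2
  simp only [sum_range_succ, sum_range_zero, Nat.factorial] at hb'
  norm_num at hb'
  have hneg : Real.exp (-l) ≤ 1 - l + l ^ 2 / 2 := by
    rw [Real.exp_neg]
    have hq := Real.quadratic_le_exp_of_nonneg h0
    rw [inv_le_comm₀ (Real.exp_pos l) (by nlinarith)]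
    refine le_trans ?_ hq
    rw [inv_le_iff_one_le_mul₀ (by nlinarith)]
    -- `(1 + l + l² / 2) * (1 - l + l² / 2) = 1 + l⁴ / 4`.
    nlinarith [sq_nonneg (l ^ 2)]
  have h3 : (l - l ^ 2) ^ 3 ≤ l ^ 3 := pow_le_pow_left₀ hx0 hxl 3
  have h4 : l ^ 4 ≤ l ^ 3 * (1 / 2) := by
    rw [pow_succ l 3]
    exact mul_le_mul_of_nonneg_left h1 (by positivity)
  have h5 : 0 ≤ l ^ 3 := by positivity
  nlinarith

/-- The exponent is quadratic in `θ` with minimiser `1 + 2 * log t`. When this is negative, `θ = 0`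
suffices, by the case `l = 1 / 2` of the previous bound. -/
lemma exists_exp_sub_mul_log_le {t : ℝ} (ht0 : 0 < t) (ht1 : t ≤ 1) :
    ∃ θ : ℝ, 0 ≤ θ ∧ θ ≤ 1 ∧ Real.exp ((1 - θ) ^ 2 / 4 - θ * Real.log t) ≤ 2 - t := by
  by_cases h : -(1 / 2) ≤ Real.log t
  · have hlog := Real.log_nonpos ht0.le ht1
    refine ⟨1 + 2 * Real.log t, by linarith, by linarith, ?_⟩
    have := exp_sub_sq_add_exp_neg_le (l := -Real.log t) (by linarith) (by linarith)
    rw [neg_neg, Real.exp_log ht0] at this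
    have e : (1 - (1 + 2 * Real.log t)) ^ 2 / 4 - (1 + 2 * Real.log t) * Real.log t
        = -Real.log t - (-Real.log t) ^ 2 := by ring
    rw [e]
    linarith
  · refine ⟨0, le_rfl, zero_le_one, ?_⟩
    have := exp_sub_sq_add_exp_neg_le (l := 1 / 2) (by norm_num) le_rfl
    have ht : t ≤ Real.exp (-(1 / 2)) := (Real.log_le_iff_le_exp ht0).1 (le_of_not_ge h)
    norm_num at this ht ⊢
    linarith

end Numeric

/-! ### Talagrand's inequality by induction -/

section Talagrand

variable {p : Ω → ℝ} {n : ℕ}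

omit [Fintype Ω] in
lemma prodWeight_nonneg {ι : Type*} [Fintype ι] (hp : ∀ a, 0 ≤ p a) (A : Finset (ι → Ω)) :
    0 ≤ prodWeight p A :=
  sum_nonneg fun _ _ => prod_nonneg fun _ _ => hp _

omit [Fintype Ω] in
lemma prodWeight_mono {ι : Type*} [Fintype ι] (hp : ∀ a, 0 ≤ p a) {A B : Finset (ι → Ω)}
    (h : A ⊆ B) : prodWeight p A ≤ prodWeight p B :=
  sum_le_sum_of_subset_of_nonneg h fun _ _ _ => prod_nonneg fun _ _ => hp _

omit [Fintype Ω] in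
lemma Finset.Nonempty.of_prodWeight_pos {ι : Type*} [Fintype ι] {A : Finset (ι → Ω)}
    (h : 0 < prodWeight p A) : A.Nonempty := by
  rw [nonempty_iff_ne_empty]
  rintro rfl
  simp [prodWeight] at h

/-- Convexity of `exp` combines two exponential moment bounds. -/
lemma sum_mul_exp_convexCombination_le {α : Type*} [Fintype α] {q : α → ℝ} (hq : ∀ x, 0 ≤ q x)
    {f g : α → ℝ} {u v : ℝ} (hu : 0 < u) (hv : 0 < v)
    (hf : u * ∑ x, q x * Real.exp (f x) ≤ 1) (hg : v * ∑ x, q x * Real.exp (g x) ≤ 1)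
    {θ : ℝ} (h0 : 0 ≤ θ) (h1 : θ ≤ 1) :
    ∑ x, q x * Real.exp (θ * f x + (1 - θ) * g x)
      ≤ Real.exp (-(θ * Real.log u) - (1 - θ) * Real.log v) := by
  have key (x : α) : Real.exp (θ * f x + (1 - θ) * g x)
      ≤ Real.exp (-(θ * Real.log u) - (1 - θ) * Real.log v)
        * (θ * (u * Real.exp (f x)) + (1 - θ) * (v * Real.exp (g x))) := by
    have hc := convexOn_exp.2 (Set.mem_univ (Real.log u + f x)) (Set.mem_univ (Real.log v + g x))
      h0 (sub_nonneg.2 h1) (by ring)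
    simp only [smul_eq_mul] at hc
    rw [Real.exp_add (Real.log u), Real.exp_add (Real.log v), Real.exp_log hu,
      Real.exp_log hv] at hc
    refine le_trans (le_of_eq ?_) (mul_le_mul_of_nonneg_left hc (Real.exp_pos _).le)
    rw [← Real.exp_add]
    congr 1
    ring
  calc ∑ x, q x * Real.exp (θ * f x + (1 - θ) * g x)
      ≤ ∑ x, q x * (Real.exp (-(θ * Real.log u) - (1 - θ) * Real.log v)
        * (θ * (u * Real.exp (f x)) + (1 - θ) * (v * Real.exp (g x)))) :=
        sum_le_sum fun x _ => mul_le_mul_of_nonneg_left (key x) (hq x)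
    _ = Real.exp (-(θ * Real.log u) - (1 - θ) * Real.log v)
        * (θ * (u * ∑ x, q x * Real.exp (f x)) + (1 - θ) * (v * ∑ x, q x * Real.exp (g x))) := by
        simp only [mul_sum, ← sum_add_distrib]
        exact sum_congr rfl fun x _ => by ring
    _ ≤ Real.exp (-(θ * Real.log u) - (1 - θ) * Real.log v) := by
        refine mul_le_of_le_one_right (Real.exp_pos _).le ?_
        have := mul_le_mul_of_nonneg_left hf h0
        have := mul_le_mul_of_nonneg_left hg (sub_nonneg.2 h1)
        linarith

/-- The bound is affine in the slice weight, so averaging over `a` replaces it by the weight of `A`.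
With `r` the ratio of the weights of `A` and its projection, the induction closes by `r * (2 - r) ≤
1`. -/
lemma sum_mul_exp_convexDistSq_cons_le (hp : ∀ a, 0 ≤ p a)
    (ih : ∀ B : Finset (Fin n → Ω),
      prodWeight p B * ∑ x, (∏ i, p (x i)) * Real.exp (convexDistSq B x / 4) ≤ 1)
    {A : Finset (Fin (n + 1) → Ω)} (hA : 0 < prodWeight p (tailImage A)) (a : Ω) :
    ∑ x : Fin n → Ω, (∏ i, p (x i)) * Real.exp (convexDistSq A (Fin.cons a x) / 4)
      ≤ (2 - prodWeight p (consSlice A a) / prodWeight p (tailImage A))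
        / prodWeight p (tailImage A) := by
  have hq (x : Fin n → Ω) : 0 ≤ ∏ i, p (x i) := prod_nonneg fun _ _ => hp _
  have hsub : consSlice A a ⊆ tailImage A := fun x hx =>
    mem_filter.2 ⟨mem_univ _, a, (mem_filter.1 hx).2⟩
  set v := prodWeight p (tailImage A)
  set u := prodWeight p (consSlice A a)
  have huv : u ≤ v := prodWeight_mono hp hsub
  rcases (prodWeight_nonneg hp (consSlice A a)).eq_or_lt with h0 | hu
  -- A slice of weight zero gives no usable `log u`; the projection alone suffices, as `exp (1 / 4)
  -- ≤ 2`.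
  · have h0' : u = 0 := h0.symm
    rw [h0', zero_div, sub_zero, le_div_iff₀ hA]
    have hexp : Real.exp (1 / 4) ≤ 2 := by
      have := exp_sub_sq_add_exp_neg_le (l := 1 / 2) (by norm_num) le_rfl
      have := Real.exp_pos (-(1 / 2))
      norm_num at *
      linarith
    calc (∑ x : Fin n → Ω, (∏ i, p (x i)) * Real.exp (convexDistSq A (Fin.cons a x) / 4)) * v
        ≤ (∑ x : Fin n → Ω, (∏ i, p (x i))
            * (Real.exp (1 / 4) * Real.exp (convexDistSq (tailImage A) x / 4))) * v := by
          refine mul_le_mul_of_nonneg_right (sum_le_sum fun x _ => ?_) hA.le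
          refine mul_le_mul_of_nonneg_left ?_ (hq x)
          rw [← Real.exp_add, Real.exp_le_exp]
          linarith [convexDistSq_cons_le_one_add (.of_prodWeight_pos hA) a x]
      _ = Real.exp (1 / 4)
          * (v * ∑ x, (∏ i, p (x i)) * Real.exp (convexDistSq (tailImage A) x / 4)) := by
          simp only [mul_sum, sum_mul]
          exact sum_congr rfl fun x _ => by ring
      _ ≤ 2 := (mul_le_of_le_one_right (Real.exp_pos _).le (ih _)).trans hexp
  · obtain ⟨θ, h0, h1, hθ⟩ := exists_exp_sub_mul_log_le (div_pos hu hA) ((div_le_one hA).2 huv)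
    rw [le_div_iff₀ hA]
    calc (∑ x : Fin n → Ω, (∏ i, p (x i)) * Real.exp (convexDistSq A (Fin.cons a x) / 4)) * v
        ≤ (∑ x : Fin n → Ω, (∏ i, p (x i)) * (Real.exp ((1 - θ) ^ 2 / 4)
            * Real.exp (θ * (convexDistSq (consSlice A a) x / 4)
              + (1 - θ) * (convexDistSq (tailImage A) x / 4)))) * v := by
          refine mul_le_mul_of_nonneg_right (sum_le_sum fun x _ => ?_) hA.le
          refine mul_le_mul_of_nonneg_left ?_ (hq x)
          rw [← Real.exp_add, Real.exp_le_exp]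
          linarith [convexDistSq_cons_le (.of_prodWeight_pos hu) x h0 h1]
      _ = Real.exp ((1 - θ) ^ 2 / 4) * (∑ x : Fin n → Ω, (∏ i, p (x i))
            * Real.exp (θ * (convexDistSq (consSlice A a) x / 4)
              + (1 - θ) * (convexDistSq (tailImage A) x / 4))) * v := by
          rw [mul_sum]
          congr 1
          exact sum_congr rfl fun x _ => by ring
      _ ≤ Real.exp ((1 - θ) ^ 2 / 4)
            * Real.exp (-(θ * Real.log u) - (1 - θ) * Real.log v) * v := by
          gcongr
          exact sum_mul_exp_convexCombination_le hq hu hA (ih _) (ih _) h0 h1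
      _ = Real.exp ((1 - θ) ^ 2 / 4 - θ * Real.log (u / v)) := by
          nth_rewrite 2 [← Real.exp_log hA]
          rw [← Real.exp_add, ← Real.exp_add, Real.log_div hu.ne' hA.ne']
          congr 1
          ring
      _ ≤ 2 - u / v := hθ

/-- **Talagrand's inequality** for a power of a finite probability space. -/
theorem prodWeight_mul_sum_exp_convexDistSq_le (hp : ∀ a, 0 ≤ p a) (hp1 : ∑ a, p a = 1) :
    ∀ {n : ℕ} (A : Finset (Fin n → Ω)),
      prodWeight p A * ∑ x, (∏ i, p (x i)) * Real.exp (convexDistSq A x / 4) ≤ 1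
  | 0, A => by
    rcases A.eq_empty_or_nonempty with rfl | ⟨a, ha⟩
    · simp [prodWeight]
    · have hA : A = {a} := by
        ext x
        simp [Subsingleton.elim x a, ha]
      have h := convexDistSq_le (IsMassOn.single ha) a
      simp only [univ_eq_empty, sum_empty] at h
      rw [Fintype.sum_subsingleton _ a, hA]
      simp only [prodWeight, sum_singleton, univ_eq_empty, prod_empty, one_mul]
      rw [Real.exp_le_one_iff, ← hA]
      linarith
  | n + 1, A => by
    have ih := fun B : Finset (Fin n → Ω) =>
      prodWeight_mul_sum_exp_convexDistSq_le hp hp1 B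
    have hsub (a : Ω) : prodWeight p (consSlice A a) ≤ prodWeight p (tailImage A) :=
      prodWeight_mono hp fun x hx => mem_filter.2 ⟨mem_univ _, a, (mem_filter.1 hx).2⟩
    rcases (prodWeight_nonneg hp (tailImage A)).eq_or_lt with h0 | hpos
    · have : prodWeight p A = 0 := by
        rw [prodWeight_eq_sum_consSlice]
        refine sum_eq_zero fun a _ => ?_
        rw [le_antisymm ((hsub a).trans h0.ge) (prodWeight_nonneg hp _), mul_zero]
      simp [this]
    · have hsum : ∑ z : Fin (n + 1) → Ω, (∏ i, p (z i)) * Real.exp (convexDistSq A z / 4)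
          ≤ (2 - prodWeight p A / prodWeight p (tailImage A)) / prodWeight p (tailImage A) := by
        calc _ = ∑ a, p a * ∑ x : Fin n → Ω,
              (∏ i, p (x i)) * Real.exp (convexDistSq A (Fin.cons a x) / 4) := by
              rw [sum_fin_cons]
              simp only [Fin.prod_univ_succ, Fin.cons_zero, Fin.cons_succ, mul_sum, mul_assoc]
          _ ≤ ∑ a, p a * ((2 - prodWeight p (consSlice A a) / prodWeight p (tailImage A))
              / prodWeight p (tailImage A)) :=
              sum_le_sum fun a _ => mul_le_mul_of_nonneg_left
                (sum_mul_exp_convexDistSq_cons_le hp ih hpos a) (hp a)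
          _ = _ := by
              simp only [← mul_div_assoc, ← sum_div, mul_sub, sum_sub_distrib, ← sum_mul, hp1,
                one_mul, ← prodWeight_eq_sum_consSlice]
      refine (mul_le_mul_of_nonneg_left hsum (prodWeight_nonneg hp A)).trans ?_
      set r := prodWeight p A / prodWeight p (tailImage A) with hr
      have : prodWeight p A * ((2 - r) / prodWeight p (tailImage A)) = r * (2 - r) := by
        rw [hr]; ring
      rw [this]
      nlinarith [sq_nonneg (r - 1)]

end Talagrand

/-! ### Certifiable Lipschitz functions -/

section Certifiable

variable {p : Ω → ℝ} {ι : Type*} [Fintype ι]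

/-- `X` is Lipschitz for the Hamming distance, and every event `r ≤ X` has, at each of its points,
a certificate of at most `c * r` coordinates. -/
structure IsLipschitzCertifiable (X : (ι → Ω) → ℕ) (c : ℕ) : Prop where
  lipschitz : ∀ x y : ι → Ω, X x ≤ X y + (univ.filter fun i => x i ≠ y i).card
  certificate : ∀ x r, r ≤ X x → ∃ J : Finset ι, J.card ≤ c * r ∧
    ∀ y : ι → Ω, (∀ i ∈ J, y i = x i) → r ≤ X y

omit [Fintype Ω] in
-- Overwrite `y` by `x` on the certificate `J`: the hybrid still has value at least `r`, and it
-- differs from `y` only where `y` and `x` differ on `J`.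
lemma IsLipschitzCertifiable.le_card_mismatch {X : (ι → Ω) → ℕ} {c : ℕ}
    (hX : IsLipschitzCertifiable X c) {x : ι → Ω} {r : ℕ} (hr : r ≤ X x) :
    ∃ J : Finset ι, J.card ≤ c * r ∧
      ∀ y : ι → Ω, r ≤ X y + (J.filter fun i => y i ≠ x i).card := by
  obtain ⟨J, hJ, h⟩ := hX.certificate x r hr
  refine ⟨J, hJ, fun y => ?_⟩
  let z : ι → Ω := fun i => if i ∈ J then x i else y i
  have hz := h z fun i hi => by simp [z, hi]
  refine (hz.trans (hX.lipschitz z y)).trans (Nat.add_le_add_left (card_le_card ?_) _)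
  intro i hi
  by_cases hiJ : i ∈ J
  · simpa [z, hiJ, eq_comm] using hi
  · simp [z, hiJ] at hi

/-- Every `y ∈ A` differs from `x` in at least `r - b` places of one fixed `J`. Average this over
the mass function and apply Cauchy–Schwarz on `J`. -/
lemma IsLipschitzCertifiable.div_le_convexDistSq [DecidableEq ι] {X : (ι → Ω) → ℕ} {c : ℕ}
    (hX : IsLipschitzCertifiable X c) {x : ι → Ω} {r : ℕ} (hr : r ≤ X x) {b : ℝ} (hb : b ≤ r)
    {A : Finset (ι → Ω)} (hA : A.Nonempty) (hAb : ∀ y ∈ A, (X y : ℝ) ≤ b) :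
    (r - b) ^ 2 / (c * r) ≤ convexDistSq A x := by
  obtain ⟨J, hJ, h⟩ := hX.le_card_mismatch hr
  refine le_convexDistSq hA fun w hw => ?_
  have h1 : (r : ℝ) - b ≤ ∑ i ∈ J, mismatch w x i := by
    calc (r : ℝ) - b = ∑ y, w y * (r - b) := by rw [← sum_mul, hw.sum_eq, one_mul]
      _ ≤ ∑ y, w y * ∑ i ∈ J, (if y i ≠ x i then 1 else 0) := by
        refine sum_le_sum fun y _ => ?_
        by_cases hy : y ∈ A
        · refine mul_le_mul_of_nonneg_left ?_ (hw.nonneg y)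
          rw [sum_boole]
          have : (r : ℝ) ≤ X y + ((J.filter fun i => y i ≠ x i).card : ℝ) := mod_cast h y
          linarith [hAb y hy]
        · simp [hw.eq_zero y hy]
      _ = ∑ i ∈ J, mismatch w x i := by
        simp only [mismatch, mul_sum]
        exact sum_comm
  have hnn : 0 ≤ ∑ i, mismatch w x i ^ 2 := sum_nonneg fun _ _ => sq_nonneg _
  -- This form also covers `c * r = 0`, where the quotient is `0`.
  refine div_le_of_le_mul₀ (by positivity) hnn ?_
  calc ((r : ℝ) - b) ^ 2 ≤ (∑ i ∈ J, mismatch w x i) ^ 2 :=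
        pow_le_pow_left₀ (sub_nonneg.2 hb) h1 2
    _ ≤ J.card * ∑ i ∈ J, mismatch w x i ^ 2 := sq_sum_le_card_mul_sum_sq
    _ ≤ (c * r : ℝ) * ∑ i, mismatch w x i ^ 2 := by
        refine mul_le_mul (mod_cast hJ) ?_ (sum_nonneg fun _ _ => sq_nonneg _) (by positivity)
        exact sum_le_sum_of_subset_of_nonneg (subset_univ J) fun _ _ _ => sq_nonneg _
    _ = _ := mul_comm _ _

/-- Markov's argument: restrict the exponential moment in Talagrand's inequality to the points with
`r ≤ X x`. -/
lemma IsLipschitzCertifiable.prodWeight_mul_le_fin (hp : ∀ a, 0 ≤ p a) (hp1 : ∑ a, p a = 1)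
    {n : ℕ} {X : (Fin n → Ω) → ℕ} {c : ℕ} (hX : IsLipschitzCertifiable X c) {r : ℕ} {b : ℝ}
    (hb : b ≤ r) :
    prodWeight p (univ.filter fun x => (X x : ℝ) ≤ b) * prodWeight p (univ.filter fun x => r ≤ X x)
      ≤ Real.exp (-((r - b) ^ 2 / (4 * (c * r)))) := by
  set A := univ.filter fun x => (X x : ℝ) ≤ b with hAdef
  rcases A.eq_empty_or_nonempty with h | hA
  · simp [h, prodWeight, Real.exp_nonneg]
  rw [Real.exp_neg, ← one_div, le_div_iff₀ (Real.exp_pos _), mul_assoc]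
  refine le_trans (mul_le_mul_of_nonneg_left ?_ (prodWeight_nonneg hp A))
    (prodWeight_mul_sum_exp_convexDistSq_le hp hp1 A)
  rw [prodWeight, sum_mul]
  refine le_trans (sum_le_sum fun x hx => ?_) (sum_le_sum_of_subset_of_nonneg (subset_univ _)
    fun x _ _ => mul_nonneg (prod_nonneg fun _ _ => hp _) (Real.exp_pos _).le)
  refine mul_le_mul_of_nonneg_left ?_ (prod_nonneg fun _ _ => hp _)
  rw [Real.exp_le_exp, mul_comm (4 : ℝ), ← div_div]
  refine div_le_div_of_nonneg_right ?_ (by norm_num)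
  exact hX.div_le_convexDistSq (mem_filter.1 hx).2 hb hA fun y hy => (mem_filter.1 hy).2

omit [Fintype Ω] in
lemma IsLipschitzCertifiable.comp_equiv {κ : Type*} [Fintype κ] {X : (ι → Ω) → ℕ} {c : ℕ}
    (hX : IsLipschitzCertifiable X c) (e : ι ≃ κ) :
    IsLipschitzCertifiable (fun x : κ → Ω => X (x ∘ e)) c where
  lipschitz x y := by
    refine (hX.lipschitz (x ∘ e) (y ∘ e)).trans (Nat.add_le_add_left ?_ _)
    refine card_le_card_of_injOn e (fun i hi => ?_) e.injective.injOn
    simpa using hi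
  certificate x r hr := by
    obtain ⟨J, hJ, h⟩ := hX.certificate (x ∘ e) r hr
    refine ⟨J.map e.toEmbedding, by simpa using hJ, fun y hy => h _ fun i hi => ?_⟩
    exact hy _ (mem_map_of_mem _ hi)

lemma prodWeight_filter_comp_equiv {κ : Type*} [Fintype κ] [DecidableEq ι] [DecidableEq κ]
    (e : ι ≃ κ) (p : Ω → ℝ) (P : (ι → Ω) → Prop) [DecidablePred P] :
    prodWeight p (univ.filter fun x : κ → Ω => P (x ∘ e)) = prodWeight p (univ.filter P) := by
  simp only [prodWeight, sum_filter]
  refine Fintype.sum_equiv (e.symm.arrowCongr (Equiv.refl Ω)) _ _ fun x => ?_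
  have hx : e.symm.arrowCongr (Equiv.refl Ω) x = x ∘ e := rfl
  rw [hx]
  simp only [Function.comp_apply, e.prod_comp fun i => p (x i)]

/-- Talagrand's inequality for certifiable Lipschitz functions. -/
theorem IsLipschitzCertifiable.prodWeight_mul_le [DecidableEq ι] (hp : ∀ a, 0 ≤ p a)
    (hp1 : ∑ a, p a = 1) {X : (ι → Ω) → ℕ} {c : ℕ} (hX : IsLipschitzCertifiable X c) {r : ℕ}
    {b : ℝ} (hb : b ≤ r) :
    prodWeight p (univ.filter fun x => (X x : ℝ) ≤ b) * prodWeight p (univ.filter fun x => r ≤ X x)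
      ≤ Real.exp (-((r - b) ^ 2 / (4 * (c * r)))) := by
  have e := Fintype.equivFin ι
  have h := (hX.comp_equiv e).prodWeight_mul_le_fin hp hp1 hb
  rwa [prodWeight_filter_comp_equiv e p fun x => (X x : ℝ) ≤ b,
    prodWeight_filter_comp_equiv e p fun x => r ≤ X x] at h

/-- Talagrand's inequality for certifiable Lipschitz functions of independent, identically
distributed variables. -/
theorem IsLipschitzCertifiable.measureReal_mul_le [MeasurableSpace Ω] [MeasurableSingletonClass Ω]
    (ν : Measure Ω) [IsProbabilityMeasure ν] {X : (ι → Ω) → ℕ} {c : ℕ}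
    (hX : IsLipschitzCertifiable X c) {r : ℕ} {b : ℝ} (hb : b ≤ r) :
    (Measure.pi fun _ : ι => ν).real {x | (X x : ℝ) ≤ b}
      * (Measure.pi fun _ : ι => ν).real {x | r ≤ X x}
      ≤ Real.exp (-((r - b) ^ 2 / (4 * (c * r)))) := by
  have key (P : (ι → Ω) → Prop) [DecidablePred P] : (Measure.pi fun _ : ι => ν).real {x | P x}
      = prodWeight (fun a => ν.real {a}) (univ.filter P) := by
    have hset : {x | P x} = ((univ.filter P : Finset (ι → Ω)) : Set (ι → Ω)) := by ext; simp
    rw [hset, ← sum_measureReal_singleton]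
    refine sum_congr rfl fun x _ => ?_
    simp [measureReal_def, ENNReal.toReal_prod]
  rw [key, key]
  refine hX.prodWeight_mul_le (fun _ => measureReal_nonneg) ?_ hb
  rw [sum_measureReal_singleton]
  simp

end Certifiable

end ConvexDistance

namespace NonCrossing

/-! ### Tail bounds around a median -/

section Tails

variable {ι Ω : Type*} [Fintype ι] [Fintype Ω]

/-- After clearing denominators the difference is `(r - m) * (r * m - b²)`. -/
lemma sub_sq_div_mono {b m r : ℝ} (hb : 0 ≤ b) (hbm : b ≤ m) (hm : 0 < m) (hmr : m ≤ r) :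
    (m - b) ^ 2 / m ≤ (r - b) ^ 2 / r := by
  rw [div_le_div_iff₀ hm (hm.trans_le hmr)]
  have h : b * b ≤ r * m := mul_le_mul (hbm.trans hmr) hbm hb (hm.le.trans hmr)
  nlinarith [mul_nonneg (sub_nonneg.2 hmr) (sub_nonneg.2 h)]

variable [MeasurableSpace Ω] [MeasurableSingletonClass Ω] {X : (ι → Ω) → ℕ} {c : ℕ}

/-- Talagrand's inequality for certifiable Lipschitz functions, with real thresholds. -/
lemma measureReal_mul_le_exp (ν : Measure Ω) [IsProbabilityMeasure ν]
    (hX : IsLipschitzCertifiable X c) {b t : ℝ} (hb : 0 ≤ b) (hbt : b ≤ t) (ht : 0 < t) :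
    (Measure.pi fun _ : ι => ν).real {x | (X x : ℝ) ≤ b}
      * (Measure.pi fun _ : ι => ν).real {x | t ≤ X x}
      ≤ Real.exp (-(1 / (4 * (c : ℝ)) * ((t - b) ^ 2 / t))) := by
  -- `X` is integer-valued, so `t` may be rounded up, which only improves the exponent.
  have hceil : {x | t ≤ (X x : ℝ)} = {x | ⌈t⌉₊ ≤ X x} := by
    ext x
    simp [Nat.ceil_le]
  rw [hceil]
  refine (hX.measureReal_mul_le ν (hbt.trans (Nat.le_ceil t))).trans ?_
  rw [Real.exp_le_exp, neg_le_neg_iff]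
  calc 1 / (4 * (c : ℝ)) * ((t - b) ^ 2 / t)
      ≤ 1 / (4 * (c : ℝ)) * ((⌈t⌉₊ - b) ^ 2 / ⌈t⌉₊) :=
        mul_le_mul_of_nonneg_left (sub_sq_div_mono hb hbt ht (Nat.le_ceil t)) (by positivity)
    _ = (⌈t⌉₊ - b) ^ 2 / (4 * (c * ⌈t⌉₊)) := by
        rw [div_mul_div_comm, one_mul, mul_assoc]

lemma measureReal_tails_le (ν : Measure Ω) [IsProbabilityMeasure ν]
    (hX : IsLipschitzCertifiable X c) {m : ℝ}
    (hm : IsMedian (Measure.pi fun _ : ι => ν) (fun x => (X x : ℝ)) m) {s : ℝ} (hs : 0 ≤ s) :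
    (Measure.pi fun _ : ι => ν).real {x | (X x : ℝ) ≤ (1 - s) * m}
        ≤ 2 * Real.exp (-(1 / (4 * (c : ℝ)) * s ^ 2 * m)) ∧
      (Measure.pi fun _ : ι => ν).real {x | (1 + s) * m ≤ (X x : ℝ)}
        ≤ 2 * Real.exp (-(1 / (4 * (c : ℝ)) * (s ^ 2 / (1 + s)) * m)) := by
  obtain ⟨hle, hge⟩ := hm
  have hempty {b : ℝ} (hb : b < 0) : {x | (X x : ℝ) ≤ b} = ∅ :=
    Set.eq_empty_of_forall_notMem fun x hx =>
      absurd (hb.trans_le (Nat.cast_nonneg (X x))) (not_lt.2 hx)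
  have hm0 : 0 ≤ m := by
    by_contra! h
    rw [hempty h, measureReal_empty] at hle
    norm_num at hle
  rcases hm0.eq_or_lt with rfl | hmpos
  · simp only [mul_zero, neg_zero, Real.exp_zero, mul_one]
    exact ⟨measureReal_le_one.trans one_le_two, measureReal_le_one.trans one_le_two⟩
  -- The thresholds are `(1 - s) * m, m` for the lower tail and `m, (1 + s) * m` for the upper one.
  -- The event at `m` has probability at least `1 / 2`, whence the factor `2`.
  constructor
  · rcases lt_or_ge ((1 - s) * m) 0 with h | h
    · rw [hempty h, measureReal_empty]
      positivity
    · have hT := measureReal_mul_le_exp ν hX h (by nlinarith : (1 - s) * m ≤ m) hmpos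
      have e : (m - (1 - s) * m) ^ 2 / m = s ^ 2 * m := by
        field_simp
        ring
      rw [e, ← mul_assoc] at hT
      have := mul_le_mul_of_nonneg_left hge
        (measureReal_nonneg (μ := Measure.pi fun _ : ι => ν) (s := {x | (X x : ℝ) ≤ (1 - s) * m}))
      linarith
  · have hT := measureReal_mul_le_exp ν hX hm0 (by nlinarith : m ≤ (1 + s) * m) (by positivity)
    have e : ((1 + s) * m - m) ^ 2 / ((1 + s) * m) = s ^ 2 / (1 + s) * m := by
      field_simp
      ring
    rw [e, ← mul_assoc] at hT
    have := mul_le_mul_of_nonneg_right hle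
      (measureReal_nonneg (μ := Measure.pi fun _ : ι => ν) (s := {x | (1 + s) * m ≤ (X x : ℝ)}))
    linarith

end Tails

/-! ### Largest non-crossing matchings are certifiable -/

section Matching

variable {d : ℕ} {A : Fin d → Type u} [∀ i, LinearOrder (A i)]

lemma IsNonCrossingMatching.subset {M N : Finset (∀ i, A i)} (hM : IsNonCrossingMatching M)
    (h : N ⊆ M) : IsNonCrossingMatching N :=
  ⟨fun e he f hf => hM.1 e (h he) f (h hf), fun e he f hf => hM.2 e (h he) f (h hf)⟩

variable [∀ i, Fintype (A i)]

lemma card_le_L {G : Hypergraph A} {M : Finset (∀ i, A i)} (hM : IsNonCrossingMatching M)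
    (hG : ∀ e ∈ M, e ∈ G) : M.card ≤ L G :=
  (isGreatest_L G).2 ⟨M, hG, hM, rfl⟩

open Classical in
/-- If whether `e` is an edge of `φ x` is decided by at most `c` coordinates of `x`, and these are
distinct coordinates for distinct edges of a matching, then `L (φ x)` is certifiable. -/
lemma isLipschitzCertifiable_L {ι Ω : Type*} [Fintype ι] {φ : (ι → Ω) → Hypergraph A} {c : ℕ}
    (N : (∀ i, A i) → Finset ι) (hcard : ∀ e, (N e).card ≤ c)
    (hlocal : ∀ e x y, (∀ j ∈ N e, y j = x j) → e ∈ φ x → e ∈ φ y)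
    (hdisj : ∀ M : Finset (∀ i, A i), IsNonCrossingMatching M →
      ∀ e ∈ M, ∀ f ∈ M, ∀ j ∈ N e, j ∈ N f → e = f) :
    IsLipschitzCertifiable (fun x => L (φ x)) c where
  lipschitz x y := by
    obtain ⟨M, hMG, hM, hMcard⟩ := (isGreatest_L (φ x)).1
    have hkeep : (M.filter fun e => e ∈ φ y).card ≤ L (φ y) :=
      card_le_L (hM.subset (Finset.filter_subset _ _)) fun e he => (Finset.mem_filter.1 he).2
    -- Each lost edge has a changed coordinate among those deciding it, and no coordinate serves two
    -- edges of `M`.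
    have hlost : (M.filter fun e => e ∉ φ y).card
        ≤ (Finset.univ.filter fun i => x i ≠ y i).card := by
      refine Finset.card_le_card_of_forall_subsingleton (fun e j => j ∈ N e) (fun e he => ?_)
        fun j _ e he f hf => ?_
      · obtain ⟨heM, hey⟩ := Finset.mem_filter.1 he
        by_contra! h
        refine hey (hlocal e x y (fun j hj => ?_) (hMG e heM))
        by_contra hne
        exact h j (Finset.mem_filter.2 ⟨Finset.mem_univ j, Ne.symm hne⟩) hj
      · exact hdisj M hM e (Finset.mem_filter.1 he.1).1 f (Finset.mem_filter.1 hf.1).1 j he.2 hf.2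
    have := M.card_filter_add_card_filter_not fun e => e ∈ φ y
    omega
  certificate x r hr := by
    obtain ⟨M, hMG, hM, hMcard⟩ := (isGreatest_L (φ x)).1
    obtain ⟨M', hsub, rfl⟩ := Finset.exists_subset_card_eq (hr.trans hMcard.ge)
    refine ⟨M'.biUnion N, ?_, fun y hy => card_le_L (hM.subset hsub) fun e he => ?_⟩
    · rw [mul_comm]
      exact Finset.card_biUnion_le_card_mul _ _ _ fun e _ => hcard e
    · exact hlocal e x y (fun j hj => hy j (Finset.mem_biUnion.2 ⟨e, he, hj⟩)) (hMG e (hsub he))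

lemma distHasConcentrationConstant_map {ι Ω : Type*} [Fintype ι] [Fintype Ω] [MeasurableSpace Ω]
    [MeasurableSingletonClass Ω] (ν : Measure Ω) [IsProbabilityMeasure ν]
    {φ : (ι → Ω) → Hypergraph A} {c : ℕ} (hφ : IsLipschitzCertifiable (fun x => L (φ x)) c) :
    DistHasConcentrationConstant ((Measure.pi fun _ : ι => ν).map φ) (1 / (4 * (c : ℝ))) := by
  intro m hm s hs
  have hreal (S : Set (Hypergraph A)) : ((Measure.pi fun _ : ι => ν).map φ).real S
      = (Measure.pi fun _ : ι => ν).real (φ ⁻¹' S) :=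
    map_measureReal_apply Measurable.of_discrete MeasurableSet.of_discrete
  simp only [IsMedian, hreal] at hm ⊢
  exact measureReal_tails_le ν hφ hm hs

end Matching

/-! ### The binomial and word models -/

section Models

variable {d : ℕ} {A : Fin d → Type u} [∀ i, LinearOrder (A i)] [∀ i, Fintype (A i)]

lemma isLipschitzCertifiable_L_setOf :
    IsLipschitzCertifiable (fun P : (∀ i, A i) → Prop => L ({e | P e} : Hypergraph A)) 1 := by
  refine isLipschitzCertifiable_L (φ := fun P : (∀ i, A i) → Prop => {e | P e})
    (fun e => {e}) (fun e => by simp) (fun e x y h he => ?_) fun M _ e _ f _ j hj hj' => ?_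
  · have := h e (Finset.mem_singleton_self e)
    simp only [Set.mem_ofPred_eq] at he ⊢
    rwa [this]
  · rw [← Finset.mem_singleton.1 hj, Finset.mem_singleton.1 hj']

/-- An edge is decided by the letters of its `d` nodes; node-disjointness keeps these coordinates
apart within a matching. -/
lemma isLipschitzCertifiable_L_wordHypergraph (k : ℕ) :
    IsLipschitzCertifiable
      (fun w : (Σ i, A i) → Fin k => L (wordHypergraph w : Hypergraph A)) d := by
  classical
  refine isLipschitzCertifiable_L (fun e => Finset.univ.image fun i => ⟨i, e i⟩)
    (fun e => ?_) (fun e x y h he i j => ?_) fun M hM e he f hf v hv hv' => ?_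
  · simpa using Finset.card_image_le (s := Finset.univ) (f := fun i => (⟨i, e i⟩ : Σ i, A i))
  · rw [h _ (Finset.mem_image_of_mem _ (Finset.mem_univ i)),
      h _ (Finset.mem_image_of_mem _ (Finset.mem_univ j))]
    exact he i j
  · obtain ⟨i, -, rfl⟩ := Finset.mem_image.1 hv
    obtain ⟨j, -, hj⟩ := Finset.mem_image.1 hv'
    by_contra hne
    obtain ⟨rfl, h⟩ := Sigma.mk.inj hj
    exact hM.1 e he f hf hne j (eq_of_heq h).symm

end Models

theorem hasConcentrationConstant_binomialModel (d : ℕ) (p : unitInterval) :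
    HasConcentrationConstant (binomialModel.{u} d p) (1 / 4) := by
  intro A _ _
  have h := distHasConcentrationConstant_map
    (unitInterval.toNNReal p • Measure.dirac True
      + unitInterval.toNNReal (unitInterval.symm p) • Measure.dirac False)
    (isLipschitzCertifiable_L_setOf (A := A))
  rw [Nat.cast_one, mul_one] at h
  -- The Bernoulli random set is the image of independent `Prop`-valued coordinates indexed by the
  -- finitely many possible edges.
  rw [binomialModel, setBernoulli_eq_map, Measure.infinitePi_eq_pi]
  simpa only [Set.mem_univ] using h

theorem hasConcentrationConstant_wordModel (d k : ℕ) (hk : 1 ≤ k) :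
    HasConcentrationConstant (wordModel.{u} d k) (1 / (4 * (d : ℝ))) := by
  intro A _ _
  have : Nonempty (Fin k) := ⟨⟨0, hk⟩⟩
  exact distHasConcentrationConstant_map _ (isLipschitzCertifiable_L_wordHypergraph k)

end NonCrossing

theorem mainTheorem11 (d : ℕ) (hd : 1 ≤ d) :
    (∀ p : unitInterval,
      NonCrossing.HasConcentrationConstant (NonCrossing.binomialModel.{u} d p) (1 / 4)) ∧
    (∀ k : ℕ, 1 ≤ k →
      NonCrossing.HasConcentrationConstant (NonCrossing.wordModel.{u} d k) (1 / (4 * (d : ℝ)))) :=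
  ⟨NonCrossing.hasConcentrationConstant_binomialModel d,
    NonCrossing.hasConcentrationConstant_wordModel d⟩
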